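/- For integers $n, i\ge 0$ let $I_n(n-i)$ be the number of permutations of $[n]=\{1,\dots,n\}$ with exactly $n-i$ inversions (so $I_n(n-i)=0$ if $n<i$), and let $S_i(x)=\sum_{n\ge 0} I_n(n-i)\,x^n$. Let $C(x)=\sum_{n\ge 0}\frac{1}{n+1}\binom{2n}{n}x^n=\frac{1-\sqrt{1-4x}}{2x}$ be the generating function of the Catalan numbers, and let $$R(x)=\frac{1-x}{1-2x}\prod_{k\ge 1}(1-x^k).$$ Then, as formal power series, $S_0(x)=R\bigl(xC(x)\bigr)$; equivalently, $S_0\bigl(x(1-x)\bigr)=R(x)$. Moreover, for every integer $i\ge 0$, $$S_i(x)=\bigl(xC(x)\bigr)^i\,R\bigl(xC(x)\bigr).$$ -/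

import Mathlib

open PowerSeries
open scoped PowerSeries.WithPiTopology

namespace FewInversions

/-- The number of inversions of a permutation `π` of an `n`-element chain:
the number of pairs `i < j` with `π i > π j`. -/
def inv {n : ℕ} (π : Equiv.Perm (Fin n)) : ℕ :=
  (Finset.univ.filter fun p : Fin n × Fin n => p.1 < p.2 ∧ π p.2 < π p.1).card

/-- `permCount n i` is the number of permutations of `[n]` with exactly `n - i` inversions,
where `n - i` is an integer (so the number is `0` if `n < i`). -/
def permCount (n i : ℕ) : ℕ :=
  (Finset.univ.filter fun π : Equiv.Perm (Fin n) => (inv π : ℤ) = (n : ℤ) - (i : ℤ)).card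

/-- The generating function of permutations of `[n]` with exactly `n - i` inversions. -/
noncomputable def S (i : ℕ) : ℤ⟦X⟧ := PowerSeries.mk fun n => (permCount n i : ℤ)

/-- The generating function of the Catalan numbers, with integer coefficients. -/
noncomputable def Cat : ℤ⟦X⟧ := PowerSeries.mk fun n => (catalan n : ℤ)

/-- `(1 - x) / (1 - 2 x)`, the generating function of integer compositions. -/
noncomputable def Comp : ℤ⟦X⟧ := (1 - X) * invOfUnit (1 - 2 * X) 1

/-- `R(x) = (1 - x) / (1 - 2 x) * ∏_{k ≥ 1} (1 - x ^ k)`; the infinite product is taken in the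
topology of coefficientwise convergence. -/
noncomputable def R : ℤ⟦X⟧ := Comp * ∏' k : ℕ, (1 - X ^ (k + 1))

/-- The series `1 / (1 - 2 x)` used above is a genuine inverse. -/
theorem Comp_mul : Comp * (1 - 2 * X) = 1 - X := by
  have h : (1 - 2 * X : ℤ⟦X⟧) * invOfUnit (1 - 2 * X) 1 = 1 :=
    mul_invOfUnit _ _ (by simp)
  rw [Comp, mul_assoc, mul_comm (invOfUnit _ _), h, mul_one]

/-- The infinite product used above converges. -/
theorem multipliable_one_sub : Multipliable fun k : ℕ => (1 - X ^ (k + 1) : ℤ⟦X⟧) :=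
  PowerSeries.WithPiTopology.multipliable_one_sub_X_pow ℤ

/-- Substitution of `x C(x)` into a power series is meaningful. -/
theorem hasSubst_X_mul_Cat : HasSubst (X * Cat : ℤ⟦X⟧) :=
  HasSubst.of_constantCoeff_zero' (by simp)

/-- Substitution of `x (1 - x)` into a power series is meaningful. -/
theorem hasSubst_X_mul_one_sub_X : HasSubst (X * (1 - X) : ℤ⟦X⟧) :=
  HasSubst.of_constantCoeff_zero' (by simp)

end FewInversions

namespace FewInversions

open Finset

/-! ### The inversion generating function -/

/-! Permutations of `[n]` have inversion series `∏_{j ≤ n} (1 - x^j) / (1 - x)^n`. Up to degree `n`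
the product agrees with Euler's infinite product `E`, so the count is the coefficient of `x^n` in
`x^i E / (1 - x)^n` (`permCount_eq_coeff`). As `(1 - 2x) R = (1 - x) E`, this is the coefficient of
`x^n` in `G (1 - 2x) / (1 - x)^(n+1)` with `G = x^i R`. By Lagrange inversion for `x = w (1 - w)`,
`w = x C(x)`, it is that of `G(x C(x))` (`lagrange_eq_subst`). -/

/-- The permutation of `Fin (n + 1)` with first value `p` whose remaining values are in the same
relative order as those of `σ`. -/
def consPerm {n : ℕ} (p : Fin (n + 1)) (σ : Equiv.Perm (Fin n)) : Equiv.Perm (Fin (n + 1)) :=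
  (finSuccEquiv' 0).trans ((Equiv.optionCongr σ).trans (finSuccEquiv' p).symm)

theorem consPerm_zero {n : ℕ} (p : Fin (n + 1)) (σ : Equiv.Perm (Fin n)) :
    consPerm p σ 0 = p := by
  simp [consPerm]

theorem consPerm_succ {n : ℕ} (p : Fin (n + 1)) (σ : Equiv.Perm (Fin n)) (j : Fin n) :
    consPerm p σ j.succ = p.succAbove (σ j) := by
  have h : finSuccEquiv' (0 : Fin (n + 1)) j.succ = some j := by
    rw [← Fin.succAbove_zero_apply, finSuccEquiv'_succAbove]
  simp [consPerm, h]

theorem consPerm_bijective (n : ℕ) :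
    Function.Bijective fun x : Fin (n + 1) × Equiv.Perm (Fin n) => consPerm x.1 x.2 := by
  rw [Fintype.bijective_iff_injective_and_card]
  constructor
  · rintro ⟨p, σ⟩ ⟨q, τ⟩ h
    have h : consPerm p σ = consPerm q τ := h
    have hpq : p = q := by rw [← consPerm_zero p σ, h, consPerm_zero]
    subst hpq
    refine Prod.ext rfl (Equiv.ext fun j => ?_)
    have hj := congrArg (fun π => π j.succ) h
    simp only [consPerm_succ] at hj
    exact Fin.succAbove_right_injective hj
  · simp [Fintype.card_perm, Nat.factorial_succ]

theorem inv_eq_sum {n : ℕ} (π : Equiv.Perm (Fin n)) :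
    inv π = ∑ i, ∑ j, if i < j ∧ π j < π i then 1 else 0 := by
  rw [inv, Finset.card_filter, ← Finset.univ_product_univ, Finset.sum_product]

/-- The first entry `p` is larger than exactly `p` later entries, and the later entries keep the
inversions of `σ`. -/
theorem inv_consPerm {n : ℕ} (p : Fin (n + 1)) (σ : Equiv.Perm (Fin n)) :
    inv (consPerm p σ) = p + inv σ := by
  have hp : (∑ j : Fin n, if p.succAbove (σ j) < p then 1 else 0) = (p : ℕ) := by
    rw [Equiv.sum_comp σ fun j => if p.succAbove j < p then 1 else 0, ← Finset.card_filter]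
    simp only [Fin.succAbove_lt_iff_castSucc_lt]
    simp only [Fin.lt_def, Fin.val_castSucc]
    rw [Fin.card_filter_val_lt]
    exact min_eq_right (Nat.lt_succ_iff.mp p.2)
  rw [inv_eq_sum, inv_eq_sum, Fin.sum_univ_succ]
  simp [-Finset.sum_boole, Fin.sum_univ_succ, consPerm_zero, consPerm_succ, hp]

/-- The generating function of the permutations of `Fin n` by number of inversions. -/
noncomputable def invSeries (n : ℕ) : ℤ⟦X⟧ := ∑ π : Equiv.Perm (Fin n), X ^ inv π

theorem coeff_invSeries (n m : ℕ) :
    coeff m (invSeries n) =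
      ((Finset.univ.filter fun π : Equiv.Perm (Fin n) => inv π = m).card : ℤ) := by
  simp [invSeries, map_sum, coeff_X_pow, eq_comm]

theorem invSeries_succ (n : ℕ) :
    invSeries (n + 1) = (∑ j ∈ range (n + 1), X ^ j) * invSeries n := by
  rw [invSeries, ← (consPerm_bijective n).sum_comp, Fintype.sum_prod_type, invSeries,
    ← Fin.sum_univ_eq_sum_range, Finset.sum_mul]
  simp only [inv_consPerm, pow_add, Finset.mul_sum]

theorem invSeries_mul_one_sub_X_pow (n : ℕ) :
    invSeries n * (1 - X) ^ n = ∏ j ∈ range n, (1 - X ^ (j + 1)) := by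
  induction n with
  | zero => simp [invSeries, inv]
  | succ n ih =>
    rw [prod_range_succ, ← ih, invSeries_succ, ← mul_neg_geom_sum]
    ring

/-! ### Truncating Euler's product -/

/-- The series `∏_{k ≥ 1} (1 - x ^ k)`. -/
noncomputable def eulerProd : ℤ⟦X⟧ := ∏' k : ℕ, (1 - X ^ (k + 1))

theorem X_pow_dvd_prod_sub_prod (n N : ℕ) (h : n ≤ N) :
    (X : ℤ⟦X⟧) ^ (n + 1) ∣
      ∏ j ∈ range N, (1 - X ^ (j + 1)) - ∏ j ∈ range n, (1 - X ^ (j + 1)) := by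
  induction N, h using Nat.le_induction with
  | base => simp
  | succ N hN ih =>
    rw [prod_range_succ, mul_sub, mul_one, sub_right_comm]
    exact dvd_sub ih (Dvd.dvd.mul_left (pow_dvd_pow X (by omega)) _)

theorem X_pow_dvd_eulerProd_sub_prod (n : ℕ) :
    (X : ℤ⟦X⟧) ^ (n + 1) ∣ eulerProd - ∏ j ∈ range n, (1 - X ^ (j + 1)) := by
  rw [X_pow_dvd_iff]
  intro m hm
  have ht := multipliable_one_sub.hasProd.tendsto_prod_nat
  rw [WithPiTopology.tendsto_iff_coeff_tendsto] at ht
  have hc : Filter.Tendsto (fun N => coeff m (∏ j ∈ range N, (1 - X ^ (j + 1) : ℤ⟦X⟧)))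
      Filter.atTop (nhds (coeff m (∏ j ∈ range n, (1 - X ^ (j + 1) : ℤ⟦X⟧)))) := by
    refine tendsto_const_nhds.congr' ?_
    filter_upwards [Filter.eventually_ge_atTop n] with N hN
    have := X_pow_dvd_iff.mp (X_pow_dvd_prod_sub_prod n N hN) m hm
    rw [map_sub, sub_eq_zero] at this
    exact this.symm
  rw [map_sub, sub_eq_zero]
  exact tendsto_nhds_unique (ht m) hc

/-! ### Lagrange inversion for `x = w (1 - w)` -/

/-- The series `1 / (1 - x)`. -/
noncomputable def geom : ℤ⟦X⟧ := PowerSeries.mk 1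

theorem geom_mul : geom * (1 - X) = 1 := mk_one_mul_one_sub_eq_one ℤ

theorem Cat_eq : Cat = 1 + X * Cat ^ 2 := by
  have h := congrArg (PowerSeries.map (Nat.castRingHom ℤ)) catalanSeries_sq_mul_X_add_one
  have hC : PowerSeries.map (Nat.castRingHom ℤ) catalanSeries = Cat := by
    ext n
    simp [Cat]
  simp only [map_add, map_mul, map_pow, map_one, map_X, hC] at h
  linear_combination -h

theorem X_mul_Cat_mul_one_sub : (X * Cat : ℤ⟦X⟧) * (1 - X * Cat) = X := by
  linear_combination X * Cat_eq

theorem coeff_geom_pow_succ (d n : ℕ) : coeff n (geom ^ (d + 1)) = ((d + n).choose d : ℤ) := by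
  rw [geom, mk_one_pow_eq_mk_choose_add, coeff_mk]

/-- The linear operator sending `G` to the series whose `n`-th coefficient is that of
`G (1 - 2 x) / (1 - x) ^ (n + 1)`. -/
noncomputable def lagrange (G : ℤ⟦X⟧) : ℤ⟦X⟧ :=
  PowerSeries.mk fun n => coeff n (G * (1 - 2 * X) * geom ^ (n + 1))

theorem lagrange_add (G H : ℤ⟦X⟧) : lagrange (G + H) = lagrange G + lagrange H := by
  ext n
  simp [lagrange, add_mul]

/-- In positive degree the coefficient vanishes because `binom(2m, m) = 2 binom(2m - 1, m)`. -/
theorem lagrange_C (c : ℤ) : lagrange (C c) = C c := by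
  ext n
  rw [lagrange, coeff_mk, mul_assoc, coeff_C_mul, coeff_C]
  rcases n with _ | n
  · simp [geom]
  · have hs : (1 - 2 * X) * geom ^ (n + 1 + 1) = geom ^ (n + 1 + 1) - 2 * (X * geom ^ (n + 1 + 1)) :=
      by ring
    have hc : (n + 1 + (n + 1)).choose (n + 1) = 2 * (n + 1 + n).choose (n + 1) := by
      rw [← add_assoc, Nat.choose_succ_succ, Nat.choose_symm_of_eq_add (by omega : n + 1 + n = n + (n + 1))]
      ring
    have h2 : (2 : ℤ⟦X⟧) = C 2 := by simp
    rw [hs, map_sub, h2, coeff_C_mul, coeff_succ_X_mul, coeff_geom_pow_succ, coeff_geom_pow_succ, hc]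
    simp

theorem lagrange_X_mul_one_sub_X_mul (G : ℤ⟦X⟧) :
    lagrange (X * (1 - X) * G) = X * lagrange G := by
  ext n
  have hs : X * (1 - X) * G * (1 - 2 * X) * geom ^ (n + 1) =
      X * (G * (1 - 2 * X) * geom ^ n) := by
    linear_combination X * G * (1 - 2 * X) * geom ^ n * geom_mul
  rw [lagrange, coeff_mk, hs]
  rcases n with _ | n
  · simp
  · rw [coeff_succ_X_mul, coeff_succ_X_mul, lagrange, coeff_mk]

theorem exists_eq_C_add_X_mul_one_sub_X_mul (G : ℤ⟦X⟧) :
    ∃ (c : ℤ) (H : ℤ⟦X⟧), G = C c + X * (1 - X) * H := by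
  obtain ⟨K, hK⟩ := X_dvd_iff.mpr (show constantCoeff (G - C (constantCoeff G)) = 0 by simp)
  -- `G - c = x K`, and dividing by `1 - x` is multiplying by `geom`.
  exact ⟨constantCoeff G, geom * K, by linear_combination hK - X * K * geom_mul⟩

/-- Both sides are additive, fix constants and turn a factor `x (1 - x)` into `x`. Writing `G = c +
x (1 - x) H` repeatedly makes their difference divisible by every power of `x`. -/
theorem lagrange_eq_subst (G : ℤ⟦X⟧) : lagrange G = subst (X * Cat : ℤ⟦X⟧) G := by
  have hs := hasSubst_X_mul_Cat
  have key : ∀ (m : ℕ) (G : ℤ⟦X⟧), X ^ m ∣ lagrange G - subst (X * Cat : ℤ⟦X⟧) G := by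
    intro m
    induction m with
    | zero => simp
    | succ m ih =>
      intro G
      obtain ⟨c, H, rfl⟩ := exists_eq_C_add_X_mul_one_sub_X_mul G
      have hX : subst (X * Cat : ℤ⟦X⟧) (X * (1 - X) : ℤ⟦X⟧) = X := by
        have h1 : subst (X * Cat : ℤ⟦X⟧) (1 : ℤ⟦X⟧) = 1 := by
          rw [← coe_substAlgHom hs, map_one]
        rw [subst_mul hs, subst_sub hs, subst_X hs, h1, X_mul_Cat_mul_one_sub]
      have hC : subst (X * Cat : ℤ⟦X⟧) (C c : ℤ⟦X⟧) = C c := subst_C c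
      rw [lagrange_add, lagrange_C, lagrange_X_mul_one_sub_X_mul, subst_add hs, subst_mul hs, hX,
        hC, add_sub_add_left_eq_sub, ← mul_sub, pow_succ']
      exact mul_dvd_mul_left X (ih H)
  rw [← sub_eq_zero]
  ext n
  exact X_pow_dvd_iff.mp (key (n + 1) G) n n.lt_succ_self

/-! ### Permutations with few inversions -/

theorem permCount_eq_coeff (n i : ℕ) :
    (permCount n i : ℤ) = coeff n (X ^ i * eulerProd * geom ^ n) := by
  rw [mul_assoc, coeff_X_pow_mul', permCount]
  split_ifs with h
  · have hprod : (∏ j ∈ range n, (1 - X ^ (j + 1) : ℤ⟦X⟧)) * geom ^ n = invSeries n := by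
      rw [← invSeries_mul_one_sub_X_pow, mul_assoc, ← mul_pow, mul_comm (1 - X) geom, geom_mul,
        one_pow, mul_one]
    have hd := X_pow_dvd_iff.mp ((X_pow_dvd_eulerProd_sub_prod n).mul_right (geom ^ n)) (n - i)
      (by omega)
    rw [sub_mul, hprod, map_sub, sub_eq_zero] at hd
    rw [hd, coeff_invSeries]
    congr 2
    refine Finset.filter_congr fun π _ => ?_
    omega
  · rw [Finset.filter_false_of_mem fun π _ => by omega]
    simp

theorem S_eq_lagrange (i : ℕ) : S i = lagrange (X ^ i * R) := by
  ext n
  rw [S, lagrange, coeff_mk, coeff_mk, permCount_eq_coeff]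
  congr 1
  change _ = X ^ i * (Comp * eulerProd) * (1 - 2 * X) * geom ^ (n + 1)
  linear_combination -X ^ i * eulerProd * geom ^ (n + 1) * Comp_mul -
    X ^ i * eulerProd * geom ^ n * geom_mul

theorem S_eq (i : ℕ) : S i = (X * Cat) ^ i * subst (X * Cat : ℤ⟦X⟧) R := by
  rw [S_eq_lagrange, lagrange_eq_subst, subst_mul hasSubst_X_mul_Cat, subst_pow hasSubst_X_mul_Cat,
    subst_X hasSubst_X_mul_Cat]

theorem subst_X_mul_Cat : subst (X * (1 - X) : ℤ⟦X⟧) (X * Cat : ℤ⟦X⟧) = X := by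
  have hs := hasSubst_X_mul_one_sub_X
  set v : ℤ⟦X⟧ := subst (X * (1 - X) : ℤ⟦X⟧) (X * Cat : ℤ⟦X⟧) with hv
  have h := congrArg (subst (X * (1 - X) : ℤ⟦X⟧)) X_mul_Cat_mul_one_sub
  have h1 : subst (X * (1 - X) : ℤ⟦X⟧) (1 : ℤ⟦X⟧) = 1 := by
    rw [← coe_substAlgHom hs, map_one]
  rw [subst_mul hs, subst_sub hs, h1, subst_X hs, ← hv] at h
  have h0 : constantCoeff v = 0 := by
    rw [hv, subst_mul hs, subst_X hs]
    simp
  -- `v (1 - v) = x (1 - x)` has roots `v = x` and `v = 1 - x`; the constant term excludes the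
  -- latter.
  have hne : (1 - v - X : ℤ⟦X⟧) ≠ 0 := fun hz => by
    have := congrArg constantCoeff hz
    simp [h0] at this
  have hmul : (v - X) * (1 - v - X) = 0 := by linear_combination h
  exact sub_eq_zero.mp ((mul_eq_zero.mp hmul).resolve_right hne)

end FewInversions

theorem theorem3 :
    FewInversions.S 0 = PowerSeries.subst (X * FewInversions.Cat : ℤ⟦X⟧) FewInversions.R ∧
    PowerSeries.subst (X * (1 - X) : ℤ⟦X⟧) (FewInversions.S 0) = FewInversions.R ∧
    ∀ i : ℕ, FewInversions.S i =
      (X * FewInversions.Cat) ^ i *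
        PowerSeries.subst (X * FewInversions.Cat : ℤ⟦X⟧) FewInversions.R := by
  have h0 : FewInversions.S 0 =
      PowerSeries.subst (X * FewInversions.Cat : ℤ⟦X⟧) FewInversions.R := by
    rw [FewInversions.S_eq, pow_zero, one_mul]
  refine ⟨h0, ?_, FewInversions.S_eq⟩
  rw [h0, PowerSeries.subst_comp_subst_apply FewInversions.hasSubst_X_mul_Cat
    FewInversions.hasSubst_X_mul_one_sub_X, FewInversions.subst_X_mul_Cat, PowerSeries.X_subst]
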